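/- Let $\Gamma$ be a finite simplicial graph with vertex set $V$ whose edges $e$ are labelled by positive even integers $m_e$. Its Artin group is $$A_\Gamma=\langle V \mid \langle v,w\rangle^{m_e}=\langle w,v\rangle^{m_e}\text{ for every edge } e=\{v,w\}\rangle,$$ where $\langle v,w\rangle^{m}=vwv\cdots$ is the alternating product of length $m$ starting with $v$, and its Coxeter group $W_\Gamma$ is the quotient of $A_\Gamma$ by the relations $v^2=1$ for all $v\in V$. For $T\subseteq V$ let $\Gamma_T$ be the full labelled subgraph of $\Gamma$ spanned by $T$ and $A_T$ the subgroup of $A_\Gamma$ generated by $T$. A set $T\subseteq V$ is called a clique if any two distinct elements of $T$ are joined by an edge. $A_\Gamma$ is said to be of FC-type if $W_{\Gamma_T}$ is finite for every clique $T$. A group $G$ is poly-free if it has a finite chain of subgroups $1=G_0\unlhd G_1\unlhd\cdots\unlhd G_n=G$ such that each $G_i/G_{i-1}$ is a free group (of possibly infinite rank), and normally poly-free if the chain can be chosen such that moreover each $G_i$ is normal in $G$. (1) If $A_\Gamma$ is of FC-type, then $A_\Gamma$ is normally poly-free. (2) If $A_T$ is poly-free for every clique $T$ of $\Gamma$, then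 $A_\Gamma$ is poly-free. (3) If $A_T$ is normally poly-free for every clique $T$ of $\Gamma$, then $A_\Gamma$ is normally poly-free. -/

import Mathlib

/-- A simplicial graph (no loops, no multiple edges) with vertex set `V` whose edges are labelled by
integers `≥ 2`. Only the values of `label` on edges matter. -/
structure LabelledGraph (V : Type*) where
  /-- The underlying simplicial graph. -/
  graph : SimpleGraph V
  /-- The label of an edge (irrelevant for pairs that are not edges). -/
  label : Sym2 V → ℕ
  two_le_label : ∀ e ∈ graph.edgeSet, 2 ≤ label e

/-- The alternating product `v * w * v * ⋯` with `m` factors, starting with `v`. -/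
def altProd {M : Type*} [Monoid M] : ℕ → M → M → M
  | 0, _, _ => 1
  | m + 1, v, w => v * altProd m w v

namespace LabelledGraph

variable {V : Type*} (Γ : LabelledGraph V)

/-- All edge labels are even. -/
def IsEven : Prop := ∀ e ∈ Γ.graph.edgeSet, Even (Γ.label e)

/-- The relators of the Artin group: the relation `vwv⋯ = wvw⋯` (both sides of length the label of
the edge) for every edge with endpoints `v` and `w`. -/
def artinRels : Set (FreeGroup V) :=
  {r | ∃ v w : V, Γ.graph.Adj v w ∧
    r = altProd (Γ.label s(v, w)) (FreeGroup.of v) (FreeGroup.of w) *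
      (altProd (Γ.label s(v, w)) (FreeGroup.of w) (FreeGroup.of v))⁻¹}

/-- The Artin group `A_Γ`. -/
abbrev ArtinGroup : Type _ := PresentedGroup Γ.artinRels

/-- The subgroup `A_T` of `A_Γ` generated by a set `T` of vertices. -/
def artinSubgroup (T : Set V) : Subgroup Γ.ArtinGroup :=
  Subgroup.closure ((fun v : V => (PresentedGroup.of v : Γ.ArtinGroup)) '' T)

/-- The full labelled subgraph `Γ_T` spanned by a set `T` of vertices. -/
def induce (T : Set V) : LabelledGraph T where
  graph := Γ.graph.induce T
  label e := Γ.label (e.map Subtype.val)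
  two_le_label := by
    intro e
    induction e using Sym2.ind with
    | _ v w => exact fun h => Γ.two_le_label s(v.1, w.1) h

open Classical in
/-- The Coxeter matrix of `Γ`: `1` on the diagonal, the label at an edge, and `0` (which stands for
`∞`, that is, for no relation) at a pair of distinct vertices that are not joined by an edge. -/
noncomputable def coxeterMatrix : CoxeterMatrix V where
  M := Matrix.of fun v w =>
    if v = w then 1 else if Γ.graph.Adj v w then Γ.label s(v, w) else 0
  isSymm := by
    ext v w
    simp only [Matrix.transpose_apply, Matrix.of_apply, eq_comm (a := w), Γ.graph.adj_comm w,
      Sym2.eq_swap (a := w)]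
  diagonal := by simp
  off_diagonal v w hvw := by
    by_cases h : Γ.graph.Adj v w
    · have := Γ.two_le_label s(v, w) h
      simp only [Matrix.of_apply, if_neg hvw, if_pos h]
      omega
    · simp [hvw, h]

/-- The Coxeter group `W_Γ`, generated by the vertices subject to `v ^ 2 = 1` for every vertex `v`
and `(v * w) ^ m = 1` for every edge with endpoints `v`, `w` and label `m`. Equivalently, it is the
quotient of the Artin group by the relations `v ^ 2 = 1`. -/
abbrev CoxeterGroup : Type _ := Γ.coxeterMatrix.Group

/-- `A_Γ` is of spherical type: the Coxeter group `W_Γ` is finite. -/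
def IsSphericalType : Prop := Finite Γ.CoxeterGroup

/-- `A_Γ` is of FC-type: for every clique `T` of `Γ`, the Artin group of the full subgraph `Γ_T` is
of spherical type. -/
def IsFCType : Prop := ∀ T : Set V, Γ.graph.IsClique T → (Γ.induce T).IsSphericalType

end LabelledGraph

/-- `H 0, …, H n` is a chain of subgroups `1 = H 0 ⊴ H 1 ⊴ ⋯ ⊴ H n = G` all of whose successive
quotients `H (i + 1) / H i` are free groups (of arbitrary, possibly infinite, rank). -/
def IsPolyFreeChain {G : Type*} [Group G] (n : ℕ) (H : ℕ → Subgroup G) : Prop :=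
  H 0 = ⊥ ∧ H n = ⊤ ∧ ∀ i < n, H i ≤ H (i + 1) ∧
    ∃ _ : ((H i).subgroupOf (H (i + 1))).Normal,
      IsFreeGroup (H (i + 1) ⧸ (H i).subgroupOf (H (i + 1)))

/-- A group is poly-free if it has a finite subnormal chain with free successive quotients. -/
def IsPolyFree (G : Type*) [Group G] : Prop :=
  ∃ (n : ℕ) (H : ℕ → Subgroup G), IsPolyFreeChain n H

/-- A group is normally poly-free if it has such a chain all of whose terms are normal in the whole
group. -/
def IsNormallyPolyFree (G : Type*) [Group G] : Prop :=
  ∃ (n : ℕ) (H : ℕ → Subgroup G), IsPolyFreeChain n H ∧ ∀ i ≤ n, (H i).Normal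

/-! ### Chains with free quotients -/

/-! Because all labels are even, killing any set of generators respects the relations, so every
$A_S$ is a retract of $A_\Gamma$. If $v,w\in T$ are distinct and not adjacent, $A_T$ maps to
$A_{T\setminus v}$ and $A_{T\setminus w}$, and the common kernel is free
(`isFreeGroup_ker_inf_ker`). Pulling back chains along both maps and intersecting them gives a chain
for $A_T$, since subgroups of free groups are free (`HasFreeChain.of_homs`). Induction on $T$
reduces everything to cliques, which proves (2) and (3).

For (1), finiteness of $W$ on triangles forces one of any two edges meeting in a clique to have
label 2 (`IsFCType.label_eq_two_or`). Hence a clique group is a direct product of groups on one or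
two generators. These have free chains: on two generators, the common kernel of the exponent sums is
free (`isFreeGroup_artinSubgroup_pair_inf_ker`).

Both freeness statements come from `isFreeGroup_of_equivariant`: an action is written down on what
should be $G$, decomposed as a quotient times a free group on commutators. -/

theorem isFreeGroup_of_injective {K : Type*} {F : Type*} [Group K] [Group F] [IsFreeGroup F]
    (φ : K →* F) (hφ : Function.Injective φ) : IsFreeGroup K :=
  IsFreeGroup.ofMulEquiv (MonoidHom.ofInjective hφ).symm

theorem isFreeGroup_of_subsingleton (G : Type*) [Group G] [Subsingleton G] : IsFreeGroup G :=
  isFreeGroup_of_injective (1 : G →* FreeGroup Empty) (Function.injective_of_subsingleton _)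

instance isFreeGroup_multiplicative_int : IsFreeGroup (Multiplicative ℤ) :=
  IsFreeGroup.ofMulEquiv (FreeGroup.mulEquivIntOfUnique : FreeGroup Unit ≃* Multiplicative ℤ)

/-- `A ⊴ B` with free quotient; if the proposition `b` holds, then moreover `A` and `B` are normal
in the whole group. -/
def FreeStep (b : Prop) {G : Type*} [Group G] (A B : Subgroup G) : Prop :=
  A ≤ B ∧ (∃ _ : (A.subgroupOf B).Normal, IsFreeGroup (B ⧸ A.subgroupOf B)) ∧
    (b → A.Normal ∧ B.Normal)

theorem freeStep_of_hom {b : Prop} {G F : Type*} [Group G] [Group F] [IsFreeGroup F]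
    {A B : Subgroup G} (hAB : A ≤ B) (φ : B →* F) (hφ : φ.ker = A.subgroupOf B)
    (hb : b → A.Normal ∧ B.Normal) : FreeStep b A B := by
  refine ⟨hAB, ?_, hb⟩
  rw [← hφ]
  exact ⟨inferInstance, isFreeGroup_of_injective (QuotientGroup.kerLift φ)
    (QuotientGroup.kerLift_injective φ)⟩

/-- The new quotient embeds in the old one via `f`, hence is free by Nielsen–Schreier. -/
theorem FreeStep.comap_inf {b : Prop} {G H : Type*} [Group G] [Group H] (f : G →* H)
    (N : Subgroup G) [N.Normal] {A B : Subgroup H} (h : FreeStep b A B) :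
    FreeStep b (N ⊓ A.comap f) (N ⊓ B.comap f) := by
  obtain ⟨hAB, ⟨hn, hfree⟩, hb⟩ := h
  have hle : (N ⊓ B.comap f).map f ≤ B := by
    rintro _ ⟨x, hx, rfl⟩
    exact hx.2
  let g : (N ⊓ B.comap f : Subgroup G) →* B :=
    (f.comp (Subgroup.subtype _)).codRestrict B fun x => x.2.2
  refine freeStep_of_hom (inf_le_inf_left _ (Subgroup.comap_mono hAB))
    ((QuotientGroup.mk' (A.subgroupOf B)).comp g) ?_ fun h => ?_
  · ext x
    have hx : (x : G) ∈ N := x.2.1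
    have hg : ((g x : B) : H) = f x := rfl
    simp [MonoidHom.mem_ker, Subgroup.mem_subgroupOf, hx, hg]
  · have := (hb h).1
    have := (hb h).2
    exact ⟨inferInstance, inferInstance⟩

/-- A common name for poly-freeness (`b = False`) and normal poly-freeness (`b = True`). -/
def HasFreeChain (b : Prop) (G : Type*) [Group G] : Prop :=
  Relation.ReflTransGen (FreeStep b) (⊥ : Subgroup G) ⊤

theorem reflTransGen_comap_inf {b : Prop} {G H : Type*} [Group G] [Group H] (f : G →* H)
    (N : Subgroup G) [N.Normal] (h : HasFreeChain b H) :
    Relation.ReflTransGen (FreeStep b) (N ⊓ f.ker) N := by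
  have := Relation.ReflTransGen.lift (fun A : Subgroup H => N ⊓ A.comap f)
    (fun _ _ hAB => FreeStep.comap_inf f N hAB) _ _ h
  simpa [Function.onFun, MonoidHom.comap_bot] using this

/-- Refines $1\le\ker f_1\cap\ker f_2\le\ker f_1\le G$: the chain of `H₂` pulls back to the middle
step, that of `H₁` to the last. -/
theorem HasFreeChain.of_homs {b : Prop} {G H₁ H₂ : Type*} [Group G] [Group H₁] [Group H₂]
    (h₁ : HasFreeChain b H₁) (h₂ : HasFreeChain b H₂) (f₁ : G →* H₁) (f₂ : G →* H₂)
    (hfree : IsFreeGroup (f₁.ker ⊓ f₂.ker : Subgroup G)) : HasFreeChain b G := by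
  refine Relation.ReflTransGen.head ?_
    ((reflTransGen_comap_inf f₂ f₁.ker h₂).trans
      (by simpa using reflTransGen_comap_inf f₁ ⊤ h₁))
  refine freeStep_of_hom bot_le (MonoidHom.id _) ?_ fun _ => ⟨inferInstance, inferInstance⟩
  ext x
  simp

theorem HasFreeChain.of_homs_of_trivial {b : Prop} {G H₁ H₂ : Type*} [Group G] [Group H₁]
    [Group H₂] (h₁ : HasFreeChain b H₁) (h₂ : HasFreeChain b H₂) (f₁ : G →* H₁) (f₂ : G →* H₂)
    (h : ∀ g, f₁ g = 1 → f₂ g = 1 → g = 1) : HasFreeChain b G := by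
  refine h₁.of_homs h₂ f₁ f₂ ?_
  have : Subsingleton (f₁.ker ⊓ f₂.ker : Subgroup G) :=
    ⟨fun x y => Subtype.ext ((h _ x.2.1 x.2.2).trans (h _ y.2.1 y.2.2).symm)⟩
  exact isFreeGroup_of_subsingleton _

theorem HasFreeChain.of_injective {b : Prop} {G H : Type*} [Group G] [Group H]
    (h : HasFreeChain b H) (f : G →* H) (hf : Function.Injective f) : HasFreeChain b G :=
  h.of_homs_of_trivial h f f fun _ hg _ => hf (hg.trans (map_one f).symm)

theorem hasFreeChain_of_isFreeGroup (b : Prop) (G : Type*) [Group G] [IsFreeGroup G] :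
    HasFreeChain b G := by
  refine Relation.ReflTransGen.single
    (freeStep_of_hom bot_le (Subgroup.subtype ⊤) ?_ fun _ => ⟨inferInstance, inferInstance⟩)
  ext x
  simp

/-! ### Comparison with poly-freeness and normal poly-freeness -/

theorem reflTransGen_iff_exists_chain {α : Type*} (r : α → α → Prop) (x y : α) :
    Relation.ReflTransGen r x y ↔
      ∃ (n : ℕ) (H : ℕ → α), H 0 = x ∧ H n = y ∧ ∀ i < n, r (H i) (H (i + 1)) := by
  constructor
  · intro h
    induction h using Relation.ReflTransGen.head_induction_on with
    | refl => exact ⟨0, fun _ => y, rfl, rfl, by simp⟩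
    | @head a c hac _ ih =>
      obtain ⟨n, H, h0, hn, hH⟩ := ih
      refine ⟨n + 1, fun i => Nat.casesOn i a H, rfl, hn, ?_⟩
      rintro (_ | i) hi
      · simpa [h0] using hac
      · exact hH i (by omega)
  · rintro ⟨n, H, rfl, rfl, hH⟩
    exact Nat.rec (fun _ => .refl) (fun k ih hk => (ih fun i hi => hk i (by omega)).tail
      (hk k (by omega))) n hH

theorem hasFreeChain_false_iff {G : Type*} [Group G] : HasFreeChain False G ↔ IsPolyFree G := by
  simp only [HasFreeChain, reflTransGen_iff_exists_chain, IsPolyFree, IsPolyFreeChain, FreeStep,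
    false_imp_iff, and_true]

theorem hasFreeChain_true_iff {G : Type*} [Group G] :
    HasFreeChain True G ↔ IsNormallyPolyFree G := by
  simp only [HasFreeChain, reflTransGen_iff_exists_chain, IsNormallyPolyFree, IsPolyFreeChain,
    FreeStep, true_imp_iff]
  refine exists₂_congr fun n H => ⟨fun ⟨h0, hn, h⟩ => ?_, fun ⟨⟨h0, hn, h⟩, hN⟩ => ?_⟩
  · refine ⟨⟨h0, hn, fun i hi => ⟨(h i hi).1, (h i hi).2.1⟩⟩, fun i hi => ?_⟩
    rcases hi.lt_or_eq with hi | rfl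
    · exact (h i hi).2.2.1
    · rw [hn]; infer_instance
  · exact ⟨h0, hn, fun i hi => ⟨(h i hi).1, (h i hi).2, hN i hi.le, hN (i + 1) hi⟩⟩

/-! ### A criterion for freeness -/

/-- Suppose that `G` acts on `Q × FreeGroup S` over the action of `G` on `Q` through `π`, that
`(q, f) ↦ τ q * ψ f` is equivariant, and that each `ψ s` acts on the fibre over `1` as translation by
`s`. Then a subgroup of `ker π` that contains the elements `ψ s` is free, with basis `ψ s`. -/
theorem isFreeGroup_of_equivariant {G Q S : Type*} [Group G] [Group Q] (K : Subgroup G)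
    (U : Set G) (hKU : K ≤ Subgroup.closure U) (π : G →* Q) (hKπ : K ≤ π.ker)
    (θ : G →* Equiv.Perm (Q × FreeGroup S)) (τ : Q → G) (ψ : FreeGroup S →* G)
    (hπ : ∀ g ∈ U, ∀ y, (θ g y).1 = π g * y.1)
    (hτ : ∀ g ∈ U, ∀ y, τ (θ g y).1 * ψ (θ g y).2 = g * (τ y.1 * ψ y.2))
    (hτ_one : τ 1 = 1) (hψK : ∀ s, ψ (FreeGroup.of s) ∈ K)
    (hψ : ∀ s f, θ (ψ (FreeGroup.of s)) (1, f) = (1, FreeGroup.of s * f)) :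
    IsFreeGroup K := by
  have key : ∀ g ∈ Subgroup.closure U, ∀ y, (θ g y).1 = π g * y.1 ∧
      τ (θ g y).1 * ψ (θ g y).2 = g * (τ y.1 * ψ y.2) := by
    intro g hg
    induction hg using Subgroup.closure_induction with
    | mem g hg => exact fun y => ⟨hπ g hg y, hτ g hg y⟩
    | one => simp
    | mul g h _ _ ihg ihh =>
      intro y
      simp only [map_mul, Equiv.Perm.mul_apply, mul_assoc]
      rw [(ihg _).1, ← (ihg _).1, (ihg _).2, (ihh _).2, (ihg _).1, (ihh _).1]
      exact ⟨rfl, rfl⟩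
    | inv g _ ih =>
      intro y
      obtain ⟨z, rfl⟩ := (θ g).surjective y
      rw [map_inv, Equiv.Perm.inv_def, Equiv.symm_apply_apply, (ih z).2, (ih z).1]
      simp
  have hψ' : ∀ x f, θ (ψ x) (1, f) = (1, x * f) := by
    intro x
    induction x using FreeGroup.induction_on with
    | C1 => simp
    | of s => exact hψ s
    | inv_of s _ =>
      intro f
      rw [map_inv, map_inv, Equiv.Perm.inv_eq_iff_eq, hψ, mul_inv_cancel_left]
    | mul x y hx hy => intro f; simp [hx, hy, mul_assoc]
  have hrange : ψ.range ≤ K := by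
    rw [MonoidHom.range_eq_map, ← FreeGroup.closure_range_of, MonoidHom.map_closure,
      Subgroup.closure_le]
    rintro _ ⟨_, ⟨s, rfl⟩, rfl⟩
    exact hψK s
  -- The orbit of `(1, 1)` decides both: `hψ'` recovers `x` from `ψ x`, and `key` writes each `k ∈
  -- K` as `ψ` of the second coordinate of `θ k (1, 1)`.
  refine IsFreeGroup.ofMulEquiv (MulEquiv.ofBijective
    (ψ.codRestrict K fun x => hrange ⟨x, rfl⟩) ⟨fun x y hxy => ?_, fun k => ?_⟩)
  · have h := hψ' x 1
    rw [show ψ x = ψ y from congrArg Subtype.val hxy, hψ'] at h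
    simpa using (congrArg Prod.snd h).symm
  · have h := key k (hKU k.2) (1, 1)
    rw [show π k = 1 from hKπ k.2] at h
    refine ⟨(θ k (1, 1)).2, Subtype.ext ?_⟩
    simpa [h.1, hτ_one] using h.2

/-- Left translations of the first factor of `Q × F`. -/
def leftTranslation (Q F : Type*) [Group Q] : Q →* Equiv.Perm (Q × F) where
  toFun q := (Equiv.mulLeft q).prodCongr (Equiv.refl F)
  map_one' := by ext <;> simp
  map_mul' _ _ := by ext <;> simp [mul_assoc]

/-- Left translations of `Q × F` in the frame given by `h : Q → F`. -/
def twist {Q F : Type*} [Group Q] [Group F] (h : Q → F) : Q →* Equiv.Perm (Q × F) :=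
  (MulAut.conj (Equiv.prodShear (Equiv.refl Q) fun q => Equiv.mulLeft (h q))⁻¹ :
    Equiv.Perm (Q × F) →* Equiv.Perm (Q × F)).comp (leftTranslation Q F)

@[simp]
theorem leftTranslation_apply {Q F : Type*} [Group Q] (q : Q) (y : Q × F) :
    leftTranslation Q F q y = (q * y.1, y.2) := rfl

@[simp]
theorem twist_apply {Q F : Type*} [Group Q] [Group F] (h : Q → F) (q : Q) (y : Q × F) :
    twist h q y = (q * y.1, (h (q * y.1))⁻¹ * (h y.1 * y.2)) := rfl

theorem twist_eq_leftTranslation {Q F : Type*} [Group Q] [Group F] {h : Q → F} {q : Q}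
    (hq : ∀ x, h (q * x) = h x) : twist h q = leftTranslation Q F q := by
  ext y <;> simp [hq]

/-! ### Alternating products -/

theorem altProd_two_mul {M : Type*} [Monoid M] (k : ℕ) (v w : M) :
    altProd (2 * k) v w = (v * w) ^ k := by
  induction k with
  | zero => simp [altProd]
  | succ k ih => rw [Nat.mul_succ, altProd, altProd, ih, pow_succ', mul_assoc]

theorem map_altProd {M N : Type*} [Monoid M] [Monoid N] (f : M →* N) (m : ℕ) (v w : M) :
    f (altProd m v w) = altProd m (f v) (f w) := by
  induction m generalizing v w with
  | zero => exact map_one f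
  | succ m ih => rw [altProd, altProd, map_mul, ih]

/-- This is where evenness enters: both sides contain $m/2$ copies of the surviving letter, so
killing one generator preserves the relation. -/
theorem altProd_one_left {M : Type*} [Monoid M] {m : ℕ} (hm : Even m) (w : M) :
    altProd m 1 w = altProd m w 1 := by
  obtain ⟨k, rfl⟩ := hm
  rw [← two_mul, altProd_two_mul, altProd_two_mul, one_mul, mul_one]

namespace LabelledGraph

variable {V : Type*} (Γ : LabelledGraph V)

/-! ### Homomorphisms from Artin groups -/

/-- The standard generators of the Artin group. -/
def gen (v : V) : Γ.ArtinGroup := PresentedGroup.of v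

/-- The universal property of the Artin group. -/
def artinLift {H : Type*} [Group H] (f : V → H)
    (hf : ∀ v w, Γ.graph.Adj v w →
      altProd (Γ.label s(v, w)) (f v) (f w) = altProd (Γ.label s(v, w)) (f w) (f v)) :
    Γ.ArtinGroup →* H :=
  PresentedGroup.toGroup (f := f) <| by
    rintro _ ⟨v, w, hvw, rfl⟩
    rw [map_mul, map_inv, map_altProd, map_altProd, FreeGroup.lift_apply_of,
      FreeGroup.lift_apply_of, hf v w hvw, mul_inv_cancel]

@[simp]
theorem artinLift_gen {H : Type*} [Group H] (f : V → H)
    (hf : ∀ v w, Γ.graph.Adj v w →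
      altProd (Γ.label s(v, w)) (f v) (f w) = altProd (Γ.label s(v, w)) (f w) (f v)) (v : V) :
    Γ.artinLift f hf (Γ.gen v) = f v :=
  PresentedGroup.toGroup.of _

theorem altProd_gen {v w : V} (h : Γ.graph.Adj v w) :
    altProd (Γ.label s(v, w)) (Γ.gen v) (Γ.gen w) =
      altProd (Γ.label s(v, w)) (Γ.gen w) (Γ.gen v) := by
  have := PresentedGroup.mk_eq_mk_of_mul_inv_mem
    (show _ ∈ Γ.artinRels from ⟨v, w, h, rfl⟩)
  rwa [map_altProd, map_altProd] at this

variable {Γ}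

theorem hom_ext {H : Type*} [Group H] {f g : Γ.ArtinGroup →* H}
    (h : ∀ v, f (Γ.gen v) = g (Γ.gen v)) : f = g :=
  PresentedGroup.ext h

theorem closure_range_gen : Subgroup.closure (Set.range Γ.gen) = ⊤ :=
  PresentedGroup.closure_range_of _

theorem gen_mem {T : Set V} {v : V} (hv : v ∈ T) : Γ.gen v ∈ Γ.artinSubgroup T :=
  Subgroup.subset_closure ⟨v, hv, rfl⟩

theorem artinSubgroup_le {T : Set V} {H : Subgroup Γ.ArtinGroup} :
    Γ.artinSubgroup T ≤ H ↔ ∀ v ∈ T, Γ.gen v ∈ H := by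
  rw [artinSubgroup, Subgroup.closure_le, Set.image_subset_iff]
  rfl

theorem artinSubgroup_univ : Γ.artinSubgroup Set.univ = ⊤ := by
  rw [artinSubgroup, Set.image_univ]
  exact closure_range_gen

theorem artinSubgroup_empty : Γ.artinSubgroup ∅ = ⊥ := by
  rw [artinSubgroup, Set.image_empty, Subgroup.closure_empty]

/-! ### Retractions of even Artin groups -/

open Classical in
/-- The homomorphism that kills the generators outside of `S` and agrees with `f` on `S`. -/
noncomputable def partialLift (hΓ : Γ.IsEven) {H : Type*} [Group H] (S : Set V) (f : V → H)
    (hf : ∀ v ∈ S, ∀ w ∈ S, Γ.graph.Adj v w →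
      altProd (Γ.label s(v, w)) (f v) (f w) = altProd (Γ.label s(v, w)) (f w) (f v)) :
    Γ.ArtinGroup →* H :=
  Γ.artinLift (fun v => if v ∈ S then f v else 1) <| by
    intro v w hvw
    have he := hΓ s(v, w) hvw
    by_cases hv : v ∈ S <;> by_cases hw : w ∈ S <;> simp only [hv, hw, if_true, if_false]
    · exact hf v hv w hw hvw
    · exact (altProd_one_left he _).symm
    · exact altProd_one_left he _

theorem partialLift_gen_of_mem (hΓ : Γ.IsEven) {H : Type*} [Group H] {S : Set V} {f : V → H}
    (hf : ∀ v ∈ S, ∀ w ∈ S, Γ.graph.Adj v w →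
      altProd (Γ.label s(v, w)) (f v) (f w) = altProd (Γ.label s(v, w)) (f w) (f v))
    {v : V} (hv : v ∈ S) : partialLift hΓ S f hf (Γ.gen v) = f v := by
  simp [partialLift, hv]

theorem partialLift_gen_of_notMem (hΓ : Γ.IsEven) {H : Type*} [Group H] {S : Set V} {f : V → H}
    (hf : ∀ v ∈ S, ∀ w ∈ S, Γ.graph.Adj v w →
      altProd (Γ.label s(v, w)) (f v) (f w) = altProd (Γ.label s(v, w)) (f w) (f v))
    {v : V} (hv : v ∉ S) : partialLift hΓ S f hf (Γ.gen v) = 1 := by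
  simp [partialLift, hv]

/-- The retraction of an even Artin group onto `A_S`. -/
noncomputable def retraction (hΓ : Γ.IsEven) (S : Set V) : Γ.ArtinGroup →* Γ.ArtinGroup :=
  partialLift hΓ S Γ.gen fun _ _ _ _ h => Γ.altProd_gen h

theorem retraction_gen_of_mem (hΓ : Γ.IsEven) {S : Set V} {v : V} (hv : v ∈ S) :
    retraction hΓ S (Γ.gen v) = Γ.gen v :=
  partialLift_gen_of_mem hΓ _ hv

theorem retraction_gen_of_notMem (hΓ : Γ.IsEven) {S : Set V} {v : V} (hv : v ∉ S) :
    retraction hΓ S (Γ.gen v) = 1 :=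
  partialLift_gen_of_notMem hΓ _ hv

theorem retraction_retraction (hΓ : Γ.IsEven) (S T : Set V) (g : Γ.ArtinGroup) :
    retraction hΓ S (retraction hΓ T g) = retraction hΓ (S ∩ T) g := by
  refine DFunLike.congr_fun (f := (retraction hΓ S).comp (retraction hΓ T)) (hom_ext fun v => ?_) g
  by_cases hT : v ∈ T
  · by_cases hS : v ∈ S
    · simp [retraction_gen_of_mem hΓ, hS, hT]
    · simp [retraction_gen_of_mem hΓ hT, retraction_gen_of_notMem hΓ hS,
        retraction_gen_of_notMem hΓ (fun h : v ∈ S ∩ T => hS h.1)]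
  · simp [retraction_gen_of_notMem hΓ hT,
        retraction_gen_of_notMem hΓ (fun h : v ∈ S ∩ T => hT h.2)]

theorem retraction_mem (hΓ : Γ.IsEven) {S T : Set V} {g : Γ.ArtinGroup}
    (hg : g ∈ Γ.artinSubgroup T) : retraction hΓ S g ∈ Γ.artinSubgroup (T ∩ S) := by
  suffices Γ.artinSubgroup T ≤ (Γ.artinSubgroup (T ∩ S)).comap (retraction hΓ S) from this hg
  refine artinSubgroup_le.2 fun v hv => ?_
  by_cases hS : v ∈ S
  · simpa [retraction_gen_of_mem hΓ hS] using gen_mem (T := T ∩ S) ⟨hv, hS⟩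
  · simp [retraction_gen_of_notMem hΓ hS, one_mem]

/-- The retraction onto `A_S`, restricted to `A_T`. -/
noncomputable def restrictedRetraction (hΓ : Γ.IsEven) (T S : Set V) :
    Γ.artinSubgroup T →* Γ.artinSubgroup (T ∩ S) :=
  ((retraction hΓ S).comp (Subgroup.subtype _)).codRestrict _ fun g => retraction_mem hΓ g.2

theorem restrictedRetraction_eq_one_iff (hΓ : Γ.IsEven) {T S : Set V} {g : Γ.artinSubgroup T} :
    restrictedRetraction hΓ T S g = 1 ↔ retraction hΓ S g = 1 :=
  Subtype.ext_iff

/-! ### The common kernel of the retractions killing one of two non-adjacent vertices -/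

/-- $A_\Gamma$ is an amalgam of $A_{V\setminus v}$ and $A_{V\setminus w}$ over
$C=A_{V\setminus\{v,w\}}$. With $N$, $M$ the kernels of their retractions to $C$, the group is
$(N*M)\rtimes C$, and the subgroup in question is the kernel of $N*M\to N\times M$, free on the
commutators of nontrivial elements. -/
theorem isFreeGroup_ker_inf_ker (hΓ : Γ.IsEven) {v w : V} (hne : v ≠ w)
    (hvw : ¬ Γ.graph.Adj v w) :
    IsFreeGroup
      ((retraction hΓ {v}ᶜ).ker ⊓ (retraction hΓ {w}ᶜ).ker : Subgroup Γ.ArtinGroup) := by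
  classical
  set ρv := retraction hΓ {v}ᶜ with hrv
  set ρw := retraction hΓ {w}ᶜ with hrw
  have vv : ∀ g, ρv (ρv g) = ρv g := fun g => by
    rw [hrv, retraction_retraction, Set.inter_self]
  have ww : ∀ g, ρw (ρw g) = ρw g := fun g => by
    rw [hrw, retraction_retraction, Set.inter_self]
  have comm : ∀ g, ρv (ρw g) = ρw (ρv g) := fun g => by
    rw [hrv, hrw, retraction_retraction, retraction_retraction, Set.inter_comm]
  have gv : ρv (Γ.gen v) = 1 := retraction_gen_of_notMem hΓ (by simp)
  have gw : ρw (Γ.gen w) = 1 := retraction_gen_of_notMem hΓ (by simp)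
  have guv : ∀ u, u ≠ v → ρv (Γ.gen u) = Γ.gen u := fun u hu => retraction_gen_of_mem hΓ hu
  have guw : ∀ u, u ≠ w → ρw (Γ.gen u) = Γ.gen u := fun u hu => retraction_gen_of_mem hΓ hu
  let π₀ : Γ.ArtinGroup →* Γ.ArtinGroup × Γ.ArtinGroup := ρv.prod ρw
  let π : Γ.ArtinGroup →* π₀.range := π₀.rangeRestrict
  have π_fst : ∀ g, (π g).1.1 = ρv g := fun _ => rfl
  have π_snd : ∀ g, (π g).1.2 = ρw g := fun _ => rfl
  -- Coordinates on the quotient $(N\times M)\rtimes C$: `c q` lies in $C$, `n q` in $N$, `m q` in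
  -- $M$.
  let c : π₀.range → Γ.ArtinGroup := fun q => ρw q.1.1
  let n : π₀.range → Γ.ArtinGroup := fun q => (c q)⁻¹ * q.1.1
  let m : π₀.range → Γ.ArtinGroup := fun q => (c q)⁻¹ * q.1.2
  let IsBasic : Γ.ArtinGroup × Γ.ArtinGroup → Prop := fun p =>
    (p.1 ≠ 1 ∧ p.2 ≠ 1) ∧ (ρv p.1 = p.1 ∧ ρw p.1 = 1) ∧ (ρw p.2 = p.2 ∧ ρv p.2 = 1)
  let ξ : Γ.ArtinGroup → Γ.ArtinGroup → FreeGroup {p // IsBasic p} := fun a b =>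
    if h : IsBasic (a, b) then FreeGroup.of ⟨(a, b), h⟩ else 1
  have ξ_left : ∀ b, ξ 1 b = 1 := fun b => dif_neg fun h => h.1.1 rfl
  have ξ_right : ∀ a, ξ a 1 = 1 := fun a => dif_neg fun h => h.1.2 rfl
  -- The change of frame between two sections: $c\,m\,n = c\,n\,m\cdot\psi(h)$.
  let h : π₀.range → FreeGroup {p // IsBasic p} := fun q => ξ (n q) (m q)
  let ψ : FreeGroup {p // IsBasic p} →* Γ.ArtinGroup :=
    FreeGroup.lift fun p => p.1.2⁻¹ * p.1.1⁻¹ * p.1.2 * p.1.1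
  have ψh : ∀ q, ψ (h q) = (m q)⁻¹ * (n q)⁻¹ * m q * n q := by
    intro q
    by_cases h1 : n q = 1
    · simp [h, h1, ξ_left]
    by_cases h2 : m q = 1
    · simp [h, h2, ξ_right]
    have hb : IsBasic (n q, m q) := by
      refine ⟨⟨h1, h2⟩, ?_⟩
      obtain ⟨_, g, rfl⟩ := q
      simp [n, m, c, π₀, vv, ww, comm]
    simp [h, ξ, hb, ψ]
  have h_mul : ∀ u, u ≠ v → u ≠ w → ∀ q, h (π (Γ.gen u) * q) = h q := by
    intro u hv hw q
    simp [h, n, m, c, π_fst, π_snd, guv u hv, guw u hw, mul_assoc]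
  -- Left multiplication by `v` is a plain translation in the frame $c\,m\,n$, that by `w` in the
  -- frame $c\,n\,m$; the other generators are translations in both. An edge never joins `v` to `w`,
  -- so each relation holds within a single frame.
  let act : V → Equiv.Perm (π₀.range × FreeGroup {p // IsBasic p}) := fun u =>
    if u = v then leftTranslation _ _ (π (Γ.gen u)) else twist h (π (Γ.gen u))
  have act_v : act v = leftTranslation _ _ (π (Γ.gen v)) := if_pos rfl
  have act_ne : ∀ u, u ≠ v → act u = twist h (π (Γ.gen u)) := fun u hu => if_neg hu
  have act_ne' : ∀ u, u ≠ w → act u = leftTranslation _ _ (π (Γ.gen u)) := by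
    intro u hu
    by_cases huv : u = v
    · rw [huv, act_v]
    · rw [act_ne u huv, twist_eq_leftTranslation (h_mul u huv hu)]
  let θ : Γ.ArtinGroup →* Equiv.Perm (π₀.range × FreeGroup {p // IsBasic p}) :=
    Γ.artinLift act <| by
      intro x y hxy
      by_cases hw : x ≠ w ∧ y ≠ w
      · rw [act_ne' x hw.1, act_ne' y hw.2, ← map_altProd, ← map_altProd, ← map_altProd,
          ← map_altProd, Γ.altProd_gen hxy]
      · have : x ≠ v ∧ y ≠ v := by
          constructor <;> rintro rfl
          · simp only [hne, ne_eq, not_false_iff, true_and, not_not] at hw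
            exact hvw (hw ▸ hxy)
          · simp only [hne, ne_eq, not_false_iff, and_true, not_not] at hw
            exact hvw (hw ▸ hxy.symm)
        rw [act_ne x this.1, act_ne y this.2, ← map_altProd, ← map_altProd, ← map_altProd,
          ← map_altProd, Γ.altProd_gen hxy]
  have θ_gen : ∀ u, θ (Γ.gen u) = act u := fun u => artinLift_gen _ _ _ u
  have θ_rv : ∀ g, ρv g = g → θ g = twist h (π g) := by
    intro g hg
    have : θ.comp ρv = ((twist h).comp π).comp ρv := hom_ext fun u => by
      by_cases hu : u = v
      · simp [hu, gv]
      · simp [guv u hu, θ_gen, act_ne u hu]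
    rw [← hg]
    exact DFunLike.congr_fun this g
  have θ_rw : ∀ g, ρw g = g → θ g = leftTranslation _ _ (π g) := by
    intro g hg
    have : θ.comp ρw = ((leftTranslation _ _).comp π).comp ρw := hom_ext fun u => by
      by_cases hu : u = w
      · simp [hu, gw]
      · simp [guw u hu, θ_gen, act_ne' u hu]
    rw [← hg]
    exact DFunLike.congr_fun this g
  have π_ker : ρv.ker ⊓ ρw.ker = π.ker := by
    ext g
    simp [π, π₀, MonoidHom.mem_ker, Prod.ext_iff]
  refine isFreeGroup_of_equivariant _ (Set.range Γ.gen) (by rw [closure_range_gen]; exact le_top)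
    π π_ker.le θ (fun q => c q * m q * n q) ψ ?_ ?_ ?_ ?_ ?_
  · rintro _ ⟨u, rfl⟩ y
    rw [θ_gen]
    by_cases hu : u = v
    · rw [hu, act_v]; rfl
    · rw [act_ne u hu]; rfl
  · rintro _ ⟨u, rfl⟩ ⟨q, f⟩
    rw [θ_gen]
    by_cases hu : u = v
    · subst hu
      simp [act_v, n, m, c, π_fst, π_snd, gv, guw u hne, mul_assoc]
    · have hm : m (π (Γ.gen u) * q) = m q := by
        by_cases hw : u = w
        · subst hw
          simp [m, c, π_fst, π_snd, guv u hu, gw]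
        · simp [m, c, π_fst, π_snd, guv u hu, guw u hw, mul_assoc]
      simp only [act_ne u hu, twist_apply, map_mul, map_inv, ψh, hm]
      simp [n, π_fst, guv u hu, mul_assoc]
  · simp [c, m, n]
  · rintro ⟨⟨a, b⟩, -, ⟨h1, h2⟩, h3, h4⟩
    dsimp only at h1 h2 h3 h4
    simp [ψ, MonoidHom.mem_ker, Subgroup.mem_inf, h1, h2, h3, h4]
  · rintro ⟨⟨a, b⟩, hab⟩ f
    obtain ⟨-, ⟨h1, h2⟩, h3, h4⟩ := id hab
    dsimp only at h1 h2 h3 h4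
    have e0 : h (π a) = 1 := by simp [h, m, n, c, π_fst, π_snd, h1, h2, ξ_right]
    have e1 : h 1 = 1 := by simp [h, m, n, c, ξ_right]
    have e2 : h (π b * π a) = FreeGroup.of ⟨(a, b), hab⟩ := by
      simp [h, m, n, c, π_fst, π_snd, h1, h2, h3, h4, ξ, hab]
    have e3 : (π a)⁻¹ * (π b * π a) = π b := by
      ext <;> simp [π_fst, π_snd, h1, h2, h3, h4]
    have e4 : h (π b) = 1 := by simp [h, m, n, c, π_fst, π_snd, h4, ξ_left]
    have hψ : ψ (FreeGroup.of ⟨(a, b), hab⟩) = b⁻¹ * a⁻¹ * b * a := by simp [ψ]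
    -- Of the four moves from `(1, f)`, only `a⁻¹`, going from `π b * π a` to `π b`, changes the
    -- free coordinate.
    rw [hψ, map_mul, map_mul, map_mul, θ_rw b⁻¹ (by simp [h3]), θ_rv a⁻¹ (by simp [h1]),
      θ_rw b h3, θ_rv a h1]
    simp only [Equiv.Perm.mul_apply, leftTranslation_apply, twist_apply, map_inv π, mul_one,
      one_mul, inv_one, e0, e1, e2, e3, e4, inv_mul_cancel]

end LabelledGraph

/-- With $a=v$ and $x=vw$, the Artin relation of length $2k$ becomes $[a,x^k]=1$. -/
theorem altProd_two_mul_comm {G : Type*} [Group G] {k : ℕ} {v w : G} :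
    altProd (2 * k) v w = altProd (2 * k) w v ↔ Commute v ((v * w) ^ k) := by
  have h : (w * v) ^ k = v⁻¹ * (v * w) ^ k * v := by
    rw [show w * v = v⁻¹ * (v * w) * v⁻¹⁻¹ by group, conj_pow, inv_inv]
  rw [altProd_two_mul, altProd_two_mul, h, commute_iff_eq, mul_assoc, eq_inv_mul_iff_mul_eq]

namespace LabelledGraph

variable {V : Type*} {Γ : LabelledGraph V}

/-! ### Artin groups on one and two generators -/

/-- The exponent sum of the generator `v`. -/
noncomputable def exponentSum (hΓ : Γ.IsEven) (v : V) : Γ.ArtinGroup →* Multiplicative ℤ :=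
  partialLift hΓ {v} (fun _ => Multiplicative.ofAdd 1) fun _ _ _ _ _ => rfl

theorem exponentSum_self (hΓ : Γ.IsEven) (v : V) :
    exponentSum hΓ v (Γ.gen v) = Multiplicative.ofAdd 1 :=
  partialLift_gen_of_mem hΓ _ rfl

theorem exponentSum_of_ne (hΓ : Γ.IsEven) {v w : V} (h : w ≠ v) :
    exponentSum hΓ v (Γ.gen w) = 1 :=
  partialLift_gen_of_notMem hΓ _ h

theorem hasFreeChain_artinSubgroup_empty (b : Prop) : HasFreeChain b (Γ.artinSubgroup ∅) := by
  have : Subsingleton (Γ.artinSubgroup ∅) := by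
    rw [artinSubgroup_empty]
    infer_instance
  have := isFreeGroup_of_subsingleton (Γ.artinSubgroup ∅)
  exact hasFreeChain_of_isFreeGroup b _

theorem hasFreeChain_artinSubgroup_singleton (hΓ : Γ.IsEven) (b : Prop) (v : V) :
    HasFreeChain b (Γ.artinSubgroup {v}) := by
  refine (hasFreeChain_of_isFreeGroup b (Multiplicative ℤ)).of_injective
    ((exponentSum hΓ v).comp (Subgroup.subtype _)) ?_
  rw [injective_iff_map_eq_one]
  rintro ⟨g, hg⟩ h
  rw [artinSubgroup, Set.image_singleton, Subgroup.mem_closure_singleton] at hg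
  obtain ⟨n, rfl⟩ := hg
  have h' : exponentSum hΓ v (Γ.gen v ^ n) = 1 := h
  rw [map_zpow, exponentSum_self, ← ofAdd_zsmul, ofAdd_eq_one] at h'
  simp only [smul_eq_mul, mul_one] at h'
  subst h'
  exact Subtype.ext (zpow_zero _)

/-- In the presentation $\langle a,x\mid [a,x^k]\rangle$, a basis is given by the commutators of
$x^j$ and $a^i$ with $i\ne0$ and $0<j<k$; the exponent of $x$ matters only modulo $k$. -/
theorem isFreeGroup_artinSubgroup_pair_inf_ker (hΓ : Γ.IsEven) {v w : V}
    (hvw : Γ.graph.Adj v w) :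
    IsFreeGroup (Γ.artinSubgroup {v, w} ⊓ ((exponentSum hΓ v).prod (exponentSum hΓ w)).ker :
      Subgroup Γ.ArtinGroup) := by
  classical
  obtain ⟨k, hk⟩ := (hΓ s(v, w) hvw).two_dvd
  have hne : v ≠ w := hvw.ne
  let π : Γ.ArtinGroup →* Multiplicative ℤ × Multiplicative ℤ :=
    (exponentSum hΓ v).prod (exponentSum hΓ w)
  set a := Γ.gen v with ha
  set x := a * Γ.gen w with hx
  let p : Multiplicative ℤ × Multiplicative ℤ := (Multiplicative.ofAdd 1, 1)
  let t : Multiplicative ℤ × Multiplicative ℤ := (Multiplicative.ofAdd 1, Multiplicative.ofAdd 1)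
  have πa : π a = p := Prod.ext (exponentSum_self hΓ v) (exponentSum_of_ne hΓ hne)
  have πb : π (Γ.gen w) = (1, Multiplicative.ofAdd 1) :=
    Prod.ext (exponentSum_of_ne hΓ hne.symm) (exponentSum_self hΓ w)
  have πx : π x = t := by
    rw [hx, map_mul, πa, πb]
    exact Prod.ext (mul_one _) (one_mul _)
  have hax : Commute a (x ^ k) := by
    have := Γ.altProd_gen hvw
    rwa [hk, altProd_two_mul_comm] at this
  -- As `k > 0`, the last condition means $0\le j<k$.
  let IsBasic : ℤ × ℤ → Prop := fun q => q.1 ≠ 0 ∧ q.2 ≠ 0 ∧ q.2 % k = q.2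
  let ξ : ℤ → ℤ → FreeGroup {q // IsBasic q} := fun i j =>
    if h : IsBasic (i, j) then FreeGroup.of ⟨(i, j), h⟩ else 1
  have ξ_left : ∀ j, ξ 0 j = 1 := fun j => dif_neg fun h => h.1 rfl
  have ξ_right : ∀ i, ξ i 0 = 1 := fun i => dif_neg fun h => h.2.1 rfl
  -- `α` and `β` are the coordinates in the basis `p`, `t`, the images of `a` and `x`.
  let α : Multiplicative ℤ × Multiplicative ℤ → ℤ := fun q => q.1.toAdd - q.2.toAdd
  let β : Multiplicative ℤ × Multiplicative ℤ → ℤ := fun q => q.2.toAdd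
  let h : Multiplicative ℤ × Multiplicative ℤ → FreeGroup {q // IsBasic q} := fun q =>
    ξ (α q) (β q % k)
  let ψ : FreeGroup {q // IsBasic q} →* Γ.ArtinGroup :=
    FreeGroup.lift fun q => (x ^ q.1.2)⁻¹ * (a ^ q.1.1)⁻¹ * x ^ q.1.2 * a ^ q.1.1
  have ψξ : ∀ i j : ℤ, j % k = j → ψ (ξ i j) = (x ^ j)⁻¹ * (a ^ i)⁻¹ * x ^ j * a ^ i := by
    intro i j hj
    by_cases h1 : i = 0
    · simp [h1, ξ_left]
    by_cases h2 : j = 0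
    · simp [h2, ξ_right]
    have hb : IsBasic (i, j) := ⟨h1, h2, hj⟩
    simp [ξ, hb, ψ]
  have ψh : ∀ q, ψ (h q) = (x ^ β q)⁻¹ * (a ^ α q)⁻¹ * x ^ β q * a ^ α q := by
    intro q
    rw [ψξ _ _ (Int.emod_emod_of_dvd _ dvd_rfl)]
    have hc : Commute ((a ^ α q)⁻¹) ((x ^ k) ^ (β q / k)) :=
      ((hax.zpow_left _).inv_left).zpow_right _
    have hβ : x ^ β q = (x ^ k) ^ (β q / k) * x ^ (β q % k) := by
      rw [← zpow_natCast x k, ← zpow_mul, ← zpow_add, Int.mul_ediv_add_emod]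
    rw [hβ, mul_inv_rev, mul_assoc _ _ ((a ^ α q)⁻¹), hc.inv_right.symm.eq]
    simp [mul_assoc]
  have h_mul : ∀ q, h (t ^ k * q) = h q := by
    intro q
    simp [h, α, β, t]
  let act : V →
      Equiv.Perm ((Multiplicative ℤ × Multiplicative ℤ) × FreeGroup {q // IsBasic q}) := fun u =>
    -- Here `a` acts by a twisted translation and `x` by a plain one; the second branch is
    -- $w=a^{-1}x$.
    if u = v then twist h p else (twist h p)⁻¹ * leftTranslation _ _ t
  have act_v : act v = twist h p := if_pos rfl
  have act_w : act w = (twist h p)⁻¹ * leftTranslation _ _ t := if_neg hne.symm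
  have act_comm : altProd (Γ.label s(v, w)) (act v) (act w) =
      altProd (Γ.label s(v, w)) (act w) (act v) := by
    -- `h` is invariant under `t ^ k`, so $x^k$ also acts by a twisted translation, and these
    -- commute since the quotient is abelian.
    rw [hk, altProd_two_mul_comm, act_v, act_w, mul_inv_cancel_left, ← map_pow,
      ← twist_eq_leftTranslation h_mul]
    exact (Commute.all p (t ^ k)).map (twist h)
  let θ : Γ.ArtinGroup →*
      Equiv.Perm ((Multiplicative ℤ × Multiplicative ℤ) × FreeGroup {q // IsBasic q}) :=
    partialLift hΓ {v, w} act <| by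
      rintro y (rfl | rfl) z (rfl | rfl) hyz
      · exact (hyz.ne rfl).elim
      · exact act_comm
      · rw [Sym2.eq_swap]
        exact act_comm.symm
      · exact (hyz.ne rfl).elim
  have θa : θ a = twist h p := (partialLift_gen_of_mem hΓ _ (Or.inl rfl)).trans act_v
  have θx : θ x = leftTranslation _ _ t := by
    have hw : θ (Γ.gen w) = act w := partialLift_gen_of_mem hΓ _ (Or.inr rfl)
    rw [hx, map_mul, θa, hw, act_w, mul_inv_cancel_left]
  have ha_mem : a ∈ Γ.artinSubgroup {v, w} := gen_mem (Or.inl rfl)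
  have hx_mem : x ∈ Γ.artinSubgroup {v, w} := mul_mem ha_mem (gen_mem (Or.inr rfl))
  have hcl : Γ.artinSubgroup {v, w} ≤ Subgroup.closure {a, x} := by
    have h1 : a ∈ Subgroup.closure {a, x} := Subgroup.subset_closure (Or.inl rfl)
    have h2 : x ∈ Subgroup.closure {a, x} := Subgroup.subset_closure (Or.inr rfl)
    refine artinSubgroup_le.2 ?_
    rintro y (rfl | rfl)
    · exact h1
    · simpa [ha, hx] using mul_mem (inv_mem h1) h2
  refine isFreeGroup_of_equivariant _ {a, x} (inf_le_left.trans hcl) π inf_le_right θ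
    (fun q => x ^ β q * a ^ α q) ψ ?_ ?_ ?_ ?_ ?_
  · rintro g (rfl | rfl) y
    · rw [θa, πa]; rfl
    · rw [θx, πx]; rfl
  · rintro g (rfl | rfl) ⟨q, f⟩
    · rw [θa]
      have h1 : α (p * q) = 1 + α q := by simp [α, p, add_sub_assoc]
      have h2 : β (p * q) = β q := by simp [β, p]
      simp only [twist_apply, map_mul, map_inv, ψh, h1, h2, zpow_add, zpow_one]
      group
    · rw [θx]
      have h1 : α (t * q) = α q := by simp [α, t]
      have h2 : β (t * q) = 1 + β q := by simp [β, t]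
      simp only [leftTranslation_apply, h1, h2, zpow_add, zpow_one, mul_assoc]
  · simp [α, β]
  · rintro ⟨⟨i, j⟩, hij⟩
    have hψ : ψ (FreeGroup.of ⟨(i, j), hij⟩) = (x ^ j)⁻¹ * (a ^ i)⁻¹ * x ^ j * a ^ i := by
      simp [ψ]
    rw [hψ]
    have hai := zpow_mem ha_mem i
    have hxj := zpow_mem hx_mem j
    refine Subgroup.mem_inf.2
      ⟨mul_mem (mul_mem (mul_mem (inv_mem hxj) (inv_mem hai)) hxj) hai, ?_⟩
    change π _ = 1
    rw [map_mul, map_mul, map_mul, map_inv, map_inv, ← mul_inv_rev, mul_assoc,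
      mul_comm (π (x ^ j)), inv_mul_cancel]
  · rintro ⟨⟨i, j⟩, hij⟩ f
    have hψ : ψ (FreeGroup.of ⟨(i, j), hij⟩) = x ^ (-j) * a ^ (-i) * x ^ j * a ^ i := by
      simp [ψ]
    have e0 : h (p ^ i) = 1 := by simp [h, α, β, p, ξ_right]
    have e1 : h 1 = 1 := by simp [h, α, β, ξ_left]
    have e2 : h (t ^ j * p ^ i) = FreeGroup.of ⟨(i, j), hij⟩ := by
      have hj : j % k = j := hij.2.2
      simp [h, α, β, p, t, ξ, hj, hij]
    have e3 : p ^ (-i) * (t ^ j * p ^ i) = t ^ j := by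
      rw [mul_left_comm, ← zpow_add]; simp
    have e4 : h (t ^ j) = 1 := by simp [h, α, β, t, ξ_left]
    have e5 : t ^ (-j) * t ^ j = 1 := by rw [← zpow_add]; simp
    rw [hψ]
    simp only [map_mul θ, map_zpow θ, θa, θx]
    simp only [← map_zpow, Equiv.Perm.mul_apply, leftTranslation_apply, twist_apply, mul_one,
      one_mul, inv_one, e0, e1, e2, e3, e4, e5]

theorem hasFreeChain_artinSubgroup_pair (hΓ : Γ.IsEven) (b : Prop) {v w : V}
    (hvw : Γ.graph.Adj v w) : HasFreeChain b (Γ.artinSubgroup {v, w}) := by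
  have hZ := hasFreeChain_of_isFreeGroup b (Multiplicative ℤ)
  refine hZ.of_homs hZ ((exponentSum hΓ v).comp (Subgroup.subtype _))
    ((exponentSum hΓ w).comp (Subgroup.subtype _)) ?_
  have := isFreeGroup_artinSubgroup_pair_inf_ker hΓ hvw
  refine isFreeGroup_of_injective
    (((Subgroup.subtype _).comp (Subgroup.subtype _)).codRestrict
      (Γ.artinSubgroup {v, w} ⊓ ((exponentSum hΓ v).prod (exponentSum hΓ w)).ker) fun g =>
        ⟨g.1.2, Prod.ext g.2.1 g.2.2⟩) fun x y hxy => ?_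
  have h := congrArg Subtype.val hxy
  exact Subtype.ext (Subtype.ext h)

/-! ### Commuting generators and non-adjacent generators -/

theorem commute_of_mem {S T : Set V} (h : ∀ s ∈ S, ∀ t ∈ T, Commute (Γ.gen s) (Γ.gen t))
    {x y : Γ.ArtinGroup} (hx : x ∈ Γ.artinSubgroup S) (hy : y ∈ Γ.artinSubgroup T) :
    Commute x y := by
  have h1 : ∀ s ∈ S, Γ.artinSubgroup T ≤ Subgroup.centralizer {Γ.gen s} := fun s hs =>
    artinSubgroup_le.2 fun t ht => Subgroup.mem_centralizer_singleton_iff.2 (h s hs t ht).symm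
  have h2 : Γ.artinSubgroup S ≤ Subgroup.centralizer {y} :=
    artinSubgroup_le.2 fun s hs => Subgroup.mem_centralizer_singleton_iff.2
      (Subgroup.mem_centralizer_singleton_iff.1 (h1 s hs hy)).symm
  exact Subgroup.mem_centralizer_singleton_iff.1 (h2 hx)

/-- The two retractions embed $A_{S\cup T}$ in $A_S\times A_T$: by commutation, each element is the
product of its images. -/
theorem hasFreeChain_artinSubgroup_union (hΓ : Γ.IsEven) {b : Prop} {S T : Set V}
    (hST : Disjoint S T) (h : ∀ s ∈ S, ∀ t ∈ T, Commute (Γ.gen s) (Γ.gen t))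
    (hS : HasFreeChain b (Γ.artinSubgroup S)) (hT : HasFreeChain b (Γ.artinSubgroup T)) :
    HasFreeChain b (Γ.artinSubgroup (S ∪ T)) := by
  have hS' : (S ∪ T) ∩ S = S := Set.union_inter_cancel_left
  have hT' : (S ∪ T) ∩ T = T := Set.union_inter_cancel_right
  have key : ∀ g ∈ Γ.artinSubgroup (S ∪ T), g = retraction hΓ S g * retraction hΓ T g := by
    intro g hg
    refine Subgroup.closure_induction (p := fun g _ => g = retraction hΓ S g * retraction hΓ T g)
      ?_ (by simp) (fun x y hx hy ihx ihy => ?_) (fun x hx ihx => ?_) hg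
    · rintro _ ⟨v, hv | hv, rfl⟩
      · exact ((congrArg₂ (· * ·) (retraction_gen_of_mem hΓ hv)
          (retraction_gen_of_notMem hΓ (Set.disjoint_left.1 hST hv))).trans (mul_one _)).symm
      · exact ((congrArg₂ (· * ·) (retraction_gen_of_notMem hΓ (Set.disjoint_right.1 hST hv))
          (retraction_gen_of_mem hΓ hv)).trans (one_mul _)).symm
    · have hc := commute_of_mem h (hS' ▸ retraction_mem hΓ (S := S) hy)
        (hT' ▸ retraction_mem hΓ (S := T) hx)
      conv_lhs => rw [ihx, ihy]
      rw [map_mul, map_mul, mul_assoc, ← mul_assoc (retraction hΓ T x), ← hc.eq]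
      simp only [mul_assoc]
    · have hc := commute_of_mem h (hS' ▸ retraction_mem hΓ (S := S) hx)
        (hT' ▸ retraction_mem hΓ (S := T) hx)
      conv_lhs => rw [ihx]
      rw [map_inv, map_inv, mul_inv_rev, hc.inv_inv.eq]
  rw [← hS'] at hS
  rw [← hT'] at hT
  refine hS.of_homs_of_trivial hT (restrictedRetraction hΓ _ S) (restrictedRetraction hΓ _ T)
    fun g h1 h2 => Subtype.ext ?_
  rw [restrictedRetraction_eq_one_iff] at h1 h2
  rw [key g g.2, h1, h2, mul_one, Subgroup.coe_one]

theorem hasFreeChain_artinSubgroup_of_not_adj (hΓ : Γ.IsEven) {b : Prop} {T : Set V} {v w : V}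
    (hne : v ≠ w) (hvw : ¬ Γ.graph.Adj v w) (hv : HasFreeChain b (Γ.artinSubgroup (T ∩ {v}ᶜ)))
    (hw : HasFreeChain b (Γ.artinSubgroup (T ∩ {w}ᶜ))) :
    HasFreeChain b (Γ.artinSubgroup T) := by
  refine hv.of_homs hw (restrictedRetraction hΓ T {v}ᶜ) (restrictedRetraction hΓ T {w}ᶜ) ?_
  have := isFreeGroup_ker_inf_ker hΓ hne hvw
  refine isFreeGroup_of_injective
    (((Subgroup.subtype _).comp (Subgroup.subtype _)).codRestrict
      ((retraction hΓ {v}ᶜ).ker ⊓ (retraction hΓ {w}ᶜ).ker) fun g =>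
        ⟨(restrictedRetraction_eq_one_iff hΓ).1 g.2.1,
          (restrictedRetraction_eq_one_iff hΓ).1 g.2.2⟩) fun x y hxy => ?_
  have h := congrArg Subtype.val hxy
  exact Subtype.ext (Subtype.ext h)

theorem hasFreeChain_of_isClique [Finite V] (hΓ : Γ.IsEven) {b : Prop}
    (h : ∀ T : Set V, Γ.graph.IsClique T → HasFreeChain b (Γ.artinSubgroup T)) :
    HasFreeChain b Γ.ArtinGroup := by
  have key : ∀ T : Set V, HasFreeChain b (Γ.artinSubgroup T) := by
    intro T
    induction T using WellFoundedLT.induction with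
    | ind T ih =>
    by_cases hT : Γ.graph.IsClique T
    · exact h T hT
    · simp only [SimpleGraph.IsClique, Set.Pairwise, not_forall] at hT
      obtain ⟨v, hv, w, hw, hne, hvw⟩ := hT
      exact hasFreeChain_artinSubgroup_of_not_adj hΓ hne hvw
        (ih _ ⟨Set.inter_subset_left, fun h => (h hv).2 rfl⟩)
        (ih _ ⟨Set.inter_subset_left, fun h => (h hw).2 rfl⟩)
  refine (key Set.univ).of_injective ((MonoidHom.id _).codRestrict _ fun g => ?_) fun x y hxy =>
    congrArg Subtype.val hxy
  rw [artinSubgroup_univ]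
  trivial

end LabelledGraph

/-! ### An infinite reflection group -/

/-- The product rotates by $\pi/k$, as $4\cos^2(\pi/2k)=2+2\cos(\pi/k)$. -/
theorem reflection_mul_reflection_pow_two_mul {M : Type*} [AddCommGroup M] [Module ℝ M]
    {x y : M} {f g : Module.Dual ℝ M} (hf : f x = 2) (hg : g y = 2) {k : ℕ} (hk : 2 ≤ k)
    (h : f y * g x = 2 + 2 * Real.cos (Real.pi / k)) :
    (Module.reflection hf * Module.reflection hg) ^ (2 * k) = 1 := by
  have hk' : (2 : ℝ) ≤ k := by exact_mod_cast hk
  have hsin : 0 < Real.sin (Real.pi / k) :=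
    Real.sin_pos_of_pos_of_lt_pi (by positivity)
      (div_lt_self Real.pi_pos (by linarith))
  -- $S_{k-1}(2\cos\theta)\sin\theta=\sin k\theta$ vanishes at $\theta=\pi/k$.
  have hS : (Polynomial.Chebyshev.S ℝ ((k : ℤ) - 1)).eval (2 * Real.cos (Real.pi / k)) = 0 := by
    have := Polynomial.Chebyshev.S_two_mul_real_cos (Real.pi / k) ((k : ℤ) - 1)
    rw [show (((k : ℤ) - 1 : ℤ) : ℝ) + 1 = k by push_cast; ring,
      mul_div_cancel₀ _ (by positivity), Real.sin_pi] at this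
    exact (mul_eq_zero.1 this).resolve_right hsin.ne'
  ext z
  rw [Module.reflection_mul_reflection_pow_apply hf hg (2 * k) z (2 * Real.cos (Real.pi / k))
    (by rw [h]; ring), show (((2 * k : ℕ) : ℤ) - 2) / 2 = k - 1 by omega,
    show (((2 * k : ℕ) : ℤ) - 1) / 2 = k - 1 by omega, hS]
  simp

/-- A linear form on `ℝ³` given by its coefficients. -/
def linearForm (a b c : ℝ) : Module.Dual ℝ (ℝ × ℝ × ℝ) :=
  a • LinearMap.fst ℝ ℝ (ℝ × ℝ) +
    (b • LinearMap.fst ℝ ℝ ℝ + c • LinearMap.snd ℝ ℝ ℝ) ∘ₗ LinearMap.snd ℝ ℝ (ℝ × ℝ)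

@[simp]
theorem linearForm_apply (a b c : ℝ) (z : ℝ × ℝ × ℝ) :
    linearForm a b c z = a * z.1 + (b * z.2.1 + c * z.2.2) := by
  simp [linearForm]

/-- The first generator of a reflection group on `ℝ³`. -/
noncomputable def refl₁ (A : ℝ) : (ℝ × ℝ × ℝ) ≃ₗ[ℝ] (ℝ × ℝ × ℝ) :=
  Module.reflection (x := ((1 : ℝ), (0 : ℝ), (0 : ℝ))) (f := linearForm 2 (-A) 0) (by simp)

/-- The second generator, which does not commute with the first and the third. -/
noncomputable def refl₂ : (ℝ × ℝ × ℝ) ≃ₗ[ℝ] (ℝ × ℝ × ℝ) :=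
  Module.reflection (x := ((0 : ℝ), (1 : ℝ), (0 : ℝ))) (f := linearForm (-1) 2 (-1)) (by simp)

/-- The third generator, which commutes with the first. -/
noncomputable def refl₃ (B : ℝ) : (ℝ × ℝ × ℝ) ≃ₗ[ℝ] (ℝ × ℝ × ℝ) :=
  Module.reflection (x := ((0 : ℝ), (0 : ℝ), (1 : ℝ))) (f := linearForm 0 (-B) 2) (by simp)

theorem refl₁_apply (A : ℝ) (z : ℝ × ℝ × ℝ) : refl₁ A z = (A * z.2.1 - z.1, z.2.1, z.2.2) := by
  ext <;> simp [refl₁, Module.reflection_apply]; ring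

theorem refl₂_apply (z : ℝ × ℝ × ℝ) : refl₂ z = (z.1, z.1 + z.2.2 - z.2.1, z.2.2) := by
  ext <;> simp [refl₂, Module.reflection_apply]; ring

theorem refl₃_apply (B : ℝ) (z : ℝ × ℝ × ℝ) : refl₃ B z = (z.1, z.2.1, B * z.2.1 - z.2.2) := by
  ext <;> simp [refl₃, Module.reflection_apply]; ring

theorem refl₁_mul_self (A : ℝ) : refl₁ A * refl₁ A = 1 := by
  ext1 z; simp [LinearEquiv.mul_apply, refl₁_apply]

theorem refl₂_mul_self : refl₂ * refl₂ = 1 := by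
  ext1 z; simp [LinearEquiv.mul_apply, refl₂_apply]

theorem refl₃_mul_self (B : ℝ) : refl₃ B * refl₃ B = 1 := by
  ext1 z; simp [LinearEquiv.mul_apply, refl₃_apply]

theorem refl₁_mul_refl₃_sq (A B : ℝ) : (refl₁ A * refl₃ B) ^ 2 = 1 := by
  ext1 z; simp [pow_two, LinearEquiv.mul_apply, refl₁_apply, refl₃_apply]

theorem refl₁_mul_refl₂_pow {k : ℕ} (hk : 2 ≤ k) :
    (refl₁ (2 + 2 * Real.cos (Real.pi / k)) * refl₂) ^ (2 * k) = 1 :=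
  reflection_mul_reflection_pow_two_mul _ _ hk (by simp)

theorem refl₃_mul_refl₂_pow {k : ℕ} (hk : 2 ≤ k) :
    (refl₃ (2 + 2 * Real.cos (Real.pi / k)) * refl₂) ^ (2 * k) = 1 :=
  reflection_mul_reflection_pow_two_mul _ _ hk (by simp)

/-- The middle coordinate of the orbit of $(1,0,0)$ grows by at least 1 at each step; the second
inequality in `key` propagates this growth. -/
theorem refl_product_pow_ne_one {A B : ℝ} (hAB : 4 ≤ A + B) {n : ℕ} (hn : n ≠ 0) :
    (refl₁ A * refl₃ B * refl₂) ^ n ≠ 1 := by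
  have key : ∀ n : ℕ, ∀ z, z = ((refl₁ A * refl₃ B * refl₂) ^ n) ((1 : ℝ), (0 : ℝ), (0 : ℝ)) →
      (n : ℝ) ≤ z.2.1 ∧ 2 * z.2.1 + 1 ≤ z.1 + z.2.2 := by
    intro n
    induction n with
    | zero => rintro _ rfl; simp
    | succ n ih =>
      rintro _ rfl
      rw [pow_succ', LinearEquiv.mul_apply]
      obtain ⟨h1, h2⟩ := ih _ rfl
      generalize ((refl₁ A * refl₃ B * refl₂) ^ n) (1, 0, 0) = z at h1 h2
      have h0 : (0 : ℝ) ≤ n := n.cast_nonneg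
      simp only [LinearEquiv.mul_apply, refl₁_apply, refl₂_apply, refl₃_apply, Nat.cast_succ]
      refine ⟨by linarith, ?_⟩
      have : 4 * (z.1 + z.2.2 - z.2.1) ≤ (A + B) * (z.1 + z.2.2 - z.2.1) :=
        mul_le_mul_of_nonneg_right hAB (by linarith)
      linarith
  intro h
  have := (key n _ rfl).1
  rw [h] at this
  change (n : ℝ) ≤ 0 at this
  exact hn (by exact_mod_cast le_antisymm this (Nat.cast_nonneg n))

theorem mul_pow_swap {G : Type*} [Group G] {x y : G} {n : ℕ} (h : (x * y) ^ n = 1) :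
    (y * x) ^ n = 1 := by
  rw [show y * x = x⁻¹ * (x * y) * x⁻¹⁻¹ by group, conj_pow, h]
  simp

namespace LabelledGraph

variable {V : Type*} {Γ : LabelledGraph V}

theorem coxeterMatrix_apply_of_adj {v w : V} (h : Γ.graph.Adj v w) :
    Γ.coxeterMatrix v w = Γ.label s(v, w) := by
  classical
  change (if v = w then 1 else if Γ.graph.Adj v w then Γ.label s(v, w) else 0) = _
  rw [if_neg h.ne, if_pos h]

/-! ### Even Artin groups of FC-type -/

/-- If both labels were at least 4, the triangle's Coxeter group would act on $\mathbb R^3$ by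
reflections, with $sut$ of infinite order. -/
theorem IsFCType.label_eq_two_or (hΓ : Γ.IsEven) (hFC : Γ.IsFCType) {s t u : V}
    (hst : Γ.graph.Adj s t) (hut : Γ.graph.Adj u t) (hsu : Γ.graph.Adj s u) :
    Γ.label s(s, t) = 2 ∨ Γ.label s(u, t) = 2 := by
  classical
  by_contra! hne
  obtain ⟨k, hk⟩ := (hΓ s(s, t) hst).two_dvd
  obtain ⟨l, hl⟩ := (hΓ s(u, t) hut).two_dvd
  obtain ⟨m, hm⟩ := (hΓ s(s, u) hsu).two_dvd
  have hk2 : 2 ≤ k := by have := Γ.two_le_label s(s, t) hst; omega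
  have hl2 : 2 ≤ l := by have := Γ.two_le_label s(u, t) hut; omega
  have hclique : Γ.graph.IsClique {s, t, u} := by
    simp [SimpleGraph.isClique_insert, hst, hsu, hut.symm]
  have hfin : Finite (Γ.induce {s, t, u}).CoxeterGroup := hFC _ hclique
  let A := 2 + 2 * Real.cos (Real.pi / k)
  let B := 2 + 2 * Real.cos (Real.pi / l)
  have hcos : ∀ n : ℕ, 2 ≤ n → 0 ≤ Real.cos (Real.pi / n) := fun n hn =>
    have : (2 : ℝ) ≤ n := by exact_mod_cast hn
    Real.cos_nonneg_of_neg_pi_div_two_le_of_le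
      (by have : 0 ≤ Real.pi / n := by positivity
          linarith [Real.pi_pos])
      (div_le_div_of_nonneg_left Real.pi_pos.le two_pos this)
  have hAB : 4 ≤ A + B := by
    have := hcos k hk2
    have := hcos l hl2
    simp only [A, B]
    linarith
  let f : V → ((ℝ × ℝ × ℝ) ≃ₗ[ℝ] (ℝ × ℝ × ℝ)) := fun x =>
    if x = s then refl₁ A else if x = t then refl₂ else refl₃ B
  have fs : f s = refl₁ A := if_pos rfl
  have ft : f t = refl₂ := by simp [f, hst.ne.symm]
  have fu : f u = refl₃ B := by simp [f, hsu.ne.symm, hut.ne]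
  have hlift : ∀ x ∈ ({s, t, u} : Set V), ∀ y ∈ ({s, t, u} : Set V), Γ.graph.Adj x y →
      (f x * f y) ^ Γ.label s(x, y) = 1 := by
    have h1 : (f s * f t) ^ Γ.label s(s, t) = 1 := by
      rw [hk, fs, ft]; exact refl₁_mul_refl₂_pow hk2
    have h2 : (f u * f t) ^ Γ.label s(u, t) = 1 := by
      rw [hl, fu, ft]; exact refl₃_mul_refl₂_pow hl2
    have h3 : (f s * f u) ^ Γ.label s(s, u) = 1 := by
      -- The reflections of `s` and `u` commute, so any even label on this edge is allowed.
      rw [hm, fs, fu, pow_mul, refl₁_mul_refl₃_sq, one_pow]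
    have hswap : ∀ {x y : V}, (f x * f y) ^ Γ.label s(x, y) = 1 →
        (f y * f x) ^ Γ.label s(y, x) = 1 := fun h => by
      rw [Sym2.eq_swap]; exact mul_pow_swap h
    rintro x (rfl | rfl | rfl) y (rfl | rfl | rfl) hxy
    · exact (hxy.ne rfl).elim
    · exact h1
    · exact h3
    · exact hswap h1
    · exact (hxy.ne rfl).elim
    · exact hswap h2
    · exact hswap h3
    · exact h2
    · exact (hxy.ne rfl).elim
  have hf_self : ∀ x ∈ ({s, t, u} : Set V), f x * f x = 1 := by
    rintro x (rfl | rfl | rfl)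
    · rw [fs, refl₁_mul_self]
    · rw [ft, refl₂_mul_self]
    · rw [fu, refl₃_mul_self]
  let M := (Γ.induce {s, t, u}).coxeterMatrix
  have hL : M.IsLiftable fun x => f x.1 := by
    intro x y
    by_cases hxy : x = y
    · subst hxy
      rw [M.diagonal, pow_one, hf_self _ x.2]
    · have hadj : Γ.graph.Adj x.1 y.1 := hclique x.2 y.2 fun h => hxy (Subtype.ext h)
      have := coxeterMatrix_apply_of_adj (Γ := Γ.induce {s, t, u}) (v := x) (w := y) hadj
      rw [this]
      exact hlift x x.2 y y.2 hadj
  let φ := M.toCoxeterSystem.lift ⟨_, hL⟩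
  have hφ : ∀ x, φ (M.simple x) = f x.1 := fun x => M.toCoxeterSystem.lift_apply_simple hL x
  let g : M.Group := M.simple ⟨s, by simp⟩ * M.simple ⟨u, by simp⟩ * M.simple ⟨t, by simp⟩
  have : Finite M.Group := hfin
  refine refl_product_pow_ne_one hAB (orderOf_pos g).ne' ?_
  have := congrArg φ (pow_orderOf_eq_one g)
  rwa [map_pow, map_one, map_mul, map_mul, hφ, hφ, hφ, fs, ft, fu] at this

theorem commute_gen {v w : V} (h : Γ.graph.Adj v w) (h2 : Γ.label s(v, w) = 2) :
    Commute (Γ.gen v) (Γ.gen w) := by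
  have := Γ.altProd_gen h
  rwa [h2, altProd_two_mul 1, altProd_two_mul 1, pow_one, pow_one] at this

/-- An edge of label other than 2 meets only edges of label 2 in the clique, so it splits off as a
direct factor; if there is none, a single vertex does. -/
theorem IsFCType.hasFreeChain_of_isClique [Finite V] (hΓ : Γ.IsEven) (hFC : Γ.IsFCType)
    (b : Prop) (T : Set V) (hT : Γ.graph.IsClique T) : HasFreeChain b (Γ.artinSubgroup T) := by
  induction T using WellFoundedLT.induction with
  | ind T ih =>
  have split : ∀ S ⊆ T, S.Nonempty → HasFreeChain b (Γ.artinSubgroup S) →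
      (∀ s ∈ S, ∀ t ∈ T \ S, Γ.label s(s, t) = 2) → HasFreeChain b (Γ.artinSubgroup T) := by
    intro S hST hne hS h2
    rw [← Set.union_sdiff_cancel hST]
    refine hasFreeChain_artinSubgroup_union hΓ Set.disjoint_sdiff_right
      (fun s hs t ht => commute_gen (hT (hST hs) ht.1 fun h => ht.2 (h ▸ hs)) (h2 s hs t ht)) hS
      (ih _ ?_ (hT.subset Set.sdiff_subset))
    obtain ⟨s, hs⟩ := hne
    exact ⟨Set.sdiff_subset, fun h => (h (hST hs)).2 hs⟩
  by_cases h : ∃ v ∈ T, ∃ w ∈ T, v ≠ w ∧ Γ.label s(v, w) ≠ 2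
  · obtain ⟨v, hv, w, hw, hne, h2⟩ := h
    have hvw := hT hv hw hne
    refine split {v, w} (Set.insert_subset hv (Set.singleton_subset_iff.2 hw)) ⟨v, Or.inl rfl⟩
      (hasFreeChain_artinSubgroup_pair hΓ b hvw) ?_
    rintro s hs t ⟨ht, hts⟩
    simp only [Set.mem_insert_iff, Set.mem_singleton_iff, not_or] at hts
    have htv := hT ht hv hts.1
    have htw := hT ht hw hts.2
    rcases hs with rfl | rfl
    · rw [Sym2.eq_swap] at h2 ⊢
      exact (hFC.label_eq_two_or hΓ hvw.symm htv htw.symm).resolve_left h2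
    · rw [Sym2.eq_swap]
      exact (hFC.label_eq_two_or hΓ hvw htw htv.symm).resolve_left h2
  · push Not at h
    rcases T.eq_empty_or_nonempty with rfl | ⟨v, hv⟩
    · exact hasFreeChain_artinSubgroup_empty b
    · refine split {v} (Set.singleton_subset_iff.2 hv) ⟨v, rfl⟩
        (hasFreeChain_artinSubgroup_singleton hΓ b v) ?_
      rintro s rfl t ⟨ht, hts⟩
      exact h s hv t ht fun h => hts h.symm

end LabelledGraph

/-! ### The main theorem -/

theorem theoremA {V : Type*} [Finite V] (Γ : LabelledGraph V) (hΓ : Γ.IsEven) :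
    (Γ.IsFCType → IsNormallyPolyFree Γ.ArtinGroup) ∧
    ((∀ T : Set V, Γ.graph.IsClique T → IsPolyFree (Γ.artinSubgroup T)) →
      IsPolyFree Γ.ArtinGroup) ∧
    ((∀ T : Set V, Γ.graph.IsClique T → IsNormallyPolyFree (Γ.artinSubgroup T)) →
      IsNormallyPolyFree Γ.ArtinGroup) := by
  simp only [← hasFreeChain_true_iff, ← hasFreeChain_false_iff]
  exact ⟨fun hFC => LabelledGraph.hasFreeChain_of_isClique hΓ
      (hFC.hasFreeChain_of_isClique hΓ True),
    LabelledGraph.hasFreeChain_of_isClique hΓ, LabelledGraph.hasFreeChain_of_isClique hΓ⟩
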